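/- Let $\mathbf F_q$ be a finite field with $q$ elements and let $\gamma_n=|\mathrm{GL}_n(\mathbf F_q)|$. For a monic polynomial $p$ let $C(p)$ be its companion matrix. Every square matrix over $\mathbf F_q$ is similar to a direct sum of companion matrices $C(\phi^i)$ with $\phi$ monic irreducible and $i\ge 1$, unique up to the order of the summands (the primary rational canonical form). For $n,k\ge 0$ let ${n\brack k}_q$ be the number of invertible $n\times n$ matrices over $\mathbf F_q$ whose primary rational canonical form has exactly $k$ summands (so ${0\brack 0}_q=1$). For a monic irreducible polynomial $\phi\in\mathbf F_q[t]$ and a sequence $b=(b_1,b_2,\ldots)$ of non-negative integers with finitely many non-zero terms, let $c_\phi(b)$ be the order of the stabilizer, in $\mathrm{GL}_N(\mathbf F_q)$ acting by conjugation on the $N\times N$ matrices, $N=\sum_i i\,b_i\deg\phi$, of the direct sum of $b_i$ copies of $C(\phi^i)$, $i\ge1$. Then, as formal power series in $x$ and $y$ over $\mathbf Q$, $$\sum_{n,k\ge 0}{n\brack k}_q\,\frac{x^n}{\gamma_n}\,y^k=\prod_{\phi\ne t}\Bigl(1+\sum_{b\neq 0}\frac{x^{\sum_i i b_i\deg\phi}\,y^{\sum_i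 b_i}}{c_\phi(b)}\Bigr),$$ where $\phi$ runs over the monic irreducible polynomials in $\mathbf F_q[t]$ other than $t$ and $b$ over the sequences as above that are not identically $0$. The inner sums and the infinite product converge in the formal sense: each coefficient is eventually constant. -/

import Mathlib

open Polynomial

namespace QStirling

/-- The companion matrix of a monic polynomial `p`: the matrix of multiplication by the variable
on `F[t]/(p)` in the basis `1, t, …, t ^ (deg p - 1)`. -/
def companion {F : Type*} [Field F] (p : F[X]) :
    Matrix (Fin p.natDegree) (Fin p.natDegree) F :=
  Matrix.of fun i j =>
    if (j : ℕ) + 1 = p.natDegree then -p.coeff i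
    else if (i : ℕ) = (j : ℕ) + 1 then 1 else 0

/-- The direct sum (block diagonal matrix) of the companion matrices of a family `f` of
polynomials. -/
def directSumCompanion {F : Type*} [Field F] {ι : Type*} [DecidableEq ι] (f : ι → F[X]) :
    Matrix (Σ j, Fin (f j).natDegree) (Σ j, Fin (f j).natDegree) F :=
  Matrix.blockDiagonal' fun j => companion (f j)

/-- The primary rational canonical form of `A` has exactly `k` summands: in a suitable basis, the
endomorphism given by `A` has as its matrix a direct sum of `k` companion matrices `C(φ ^ m)`,
where each `φ` is monic irreducible and each `m` is at least `1`. -/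
def HasPrimarySummands {F : Type*} [Field F] {n : ℕ} (A : Matrix (Fin n) (Fin n) F) (k : ℕ) :
    Prop :=
  ∃ (φ : Fin k → F[X]) (m : Fin k → ℕ),
    (∀ j, (φ j).Monic ∧ Irreducible (φ j) ∧ 1 ≤ m j) ∧
    ∃ v : Module.Basis (Σ j, Fin (φ j ^ m j).natDegree) F (Fin n → F),
      LinearMap.toMatrix v v (Matrix.toLin' A) = directSumCompanion fun j => φ j ^ m j

/-- The `q`-Stirling cycle number: the number of invertible `n × n` matrices over `F` whose
primary rational canonical form has `k` summands. -/
noncomputable def cycleNumber (F : Type*) [Field F] (n k : ℕ) : ℕ :=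
  Nat.card {A : GL (Fin n) F // HasPrimarySummands (A : Matrix (Fin n) (Fin n) F) k}

/-- `γ_n`, the order of the general linear group. -/
noncomputable def glOrder (F : Type*) [Field F] (n : ℕ) : ℕ :=
  Nat.card (GL (Fin n) F)

/-- The rational canonical form with multiplicity data `b` at `φ`: the direct sum, over `i ≥ 1`, of
`b i` copies of the companion matrix `C(φ ^ i)`. -/
noncomputable def canonicalForm {F : Type*} [Field F] (φ : F[X]) (b : ℕ+ →₀ ℕ) :=
  directSumCompanion fun j : (Σ i : b.support, Fin (b i)) => φ ^ ((j.1 : ℕ+) : ℕ)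

/-- The order of the stabilizer of `A` in the general linear group acting by conjugation on square
matrices. -/
noncomputable def stabilizerOrder {F : Type*} [Field F] {m : Type*} [Fintype m] [DecidableEq m]
    (A : Matrix m m F) : ℕ :=
  Nat.card (MulAction.stabilizer (ConjAct (GL m F)) A)

/-- `c_φ(b)`: the order of the stabilizer under conjugation of the rational canonical form with
multiplicity data `b` at `φ`. -/
noncomputable def centralizerOrder {F : Type*} [Field F] (φ : F[X]) (b : ℕ+ →₀ ℕ) : ℕ :=
  stabilizerOrder (canonicalForm φ b)

/-- `∑ i * b i`, the integer of which `b` is a partition. -/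
def size (b : ℕ+ →₀ ℕ) : ℕ := b.sum fun i m => (i : ℕ) * m

/-- `∑ b i`, the number of parts of the partition `b`. -/
def parts (b : ℕ+ →₀ ℕ) : ℕ := b.sum fun _ m => m

/-- The topology of formal power series in two variables over `ℚ`: coefficientwise convergence,
with `ℚ` discrete (each coefficient is eventually constant). -/
instance formalTopology : TopologicalSpace (MvPowerSeries (Fin 2) ℚ) :=
  @MvPowerSeries.WithPiTopology.instTopologicalSpace (Fin 2) ℚ ⊥

/-- The variable `x`. -/
noncomputable def x : MvPowerSeries (Fin 2) ℚ := MvPowerSeries.X 0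

/-- The variable `y`. -/
noncomputable def y : MvPowerSeries (Fin 2) ℚ := MvPowerSeries.X 1

/-- The formal power series whose coefficient at `x ^ n * y ^ k` is the `q`-Stirling cycle number
of `n` and `k` divided by `γ_n`. -/
noncomputable def cycleSeries (F : Type*) [Field F] : MvPowerSeries (Fin 2) ℚ :=
  fun d => (cycleNumber F (d 0) (d 1) : ℚ) / (glOrder F (d 0) : ℚ)

/-- The term `x ^ (∑ i * b i * deg φ) * y ^ (∑ b i) / c_φ(b)`. -/
noncomputable def term {F : Type*} [Field F] (φ : F[X]) (b : ℕ+ →₀ ℕ) :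
    MvPowerSeries (Fin 2) ℚ :=
  (centralizerOrder φ b : ℚ)⁻¹ • (x ^ (size b * φ.natDegree) * y ^ parts b)

end QStirling

namespace QStirling

/-- The `F[X]`-module on column vectors in which `X` acts as the matrix `A`. -/
abbrev MatMod {F : Type*} [Field F] {m : Type*} [Fintype m] [DecidableEq m]
    (A : Matrix m m F) : Type _ :=
  Module.AEval' (Matrix.toLin' A)

/-- The cyclic `F[X]`-module with annihilator generated by `f`. -/
abbrev Cyc {F : Type*} [Field F] (f : F[X]) : Type _ := F[X] ⧸ Ideal.span {f}

/-! ### Matrices as `F[X]`-modules, and orbit counting -/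

section MatrixModules

variable {F : Type*} [Field F] {m : Type*} [Fintype m] [DecidableEq m]
  {N : Type*} [AddCommGroup N] [Module F N] [Module F[X] N] [IsScalarTower F F[X] N]

/-- If `X` acts on a basis `v` of `N` by the matrix `M`, then `N` is the module attached to `M`. -/
noncomputable def matModEquivOfBasis (v : Module.Basis m F N) (M : Matrix m m F)
    (h : ∀ j, (X : F[X]) • v j = ∑ i, M i j • v i) : MatMod M ≃ₗ[F[X]] N :=
  LinearEquiv.ofAEval (Matrix.toLin' M) v.equivFun.symm (by
    intro w
    have h2 : (v.equivFun.symm : (m → F) →ₗ[F] N) ∘ₗ Matrix.toLin' M =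
        (Algebra.lsmul F F N (X : F[X])) ∘ₗ (v.equivFun.symm : (m → F) →ₗ[F] N) := by
      refine (Pi.basisFun F m).ext fun j => ?_
      simp [Module.Basis.equivFun_symm_apply, h, Pi.single_apply]
    exact LinearMap.congr_fun h2 w)

/-- Isomorphisms out of the module of a matrix are the linear maps that intertwine the matrix
and `X`. -/
noncomputable def matModLinearEquivEquiv (A : Matrix m m F) :
    (MatMod A ≃ₗ[F[X]] N) ≃
      {e : (m → F) ≃ₗ[F] N // ∀ w, e (A.mulVec w) = (X : F[X]) • e w} where
  toFun e := ⟨(Module.AEval'.of (Matrix.toLin' A)).trans (e.restrictScalars F), fun w => by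
    have := e.map_smul (X : F[X]) (Module.AEval'.of (Matrix.toLin' A) w)
    rw [Module.AEval'.X_smul_of] at this
    simpa using this⟩
  invFun e := LinearEquiv.ofAEval (Matrix.toLin' A) e.1 e.2
  left_inv e := by ext w; rfl
  right_inv e := by ext w; rfl

/-- Composition with an isomorphism, as a bijection of sets of isomorphisms. -/
def linearEquivCongrRight {R M P Q : Type*} [Semiring R] [AddCommMonoid M] [AddCommMonoid P]
    [AddCommMonoid Q] [Module R M] [Module R P] [Module R Q] (f : P ≃ₗ[R] Q) :
    (M ≃ₗ[R] P) ≃ (M ≃ₗ[R] Q) where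
  toFun e := e.trans f
  invFun e := e.trans f.symm
  left_inv e := by ext; simp
  right_inv e := by ext; simp

/-- Precomposition with an isomorphism, as a bijection of sets of isomorphisms. -/
def linearEquivCongrLeft {R M P Q : Type*} [Semiring R] [AddCommMonoid M] [AddCommMonoid P]
    [AddCommMonoid Q] [Module R M] [Module R P] [Module R Q] (f : P ≃ₗ[R] Q) :
    (P ≃ₗ[R] M) ≃ (Q ≃ₗ[R] M) where
  toFun e := f.symm.trans e
  invFun e := f.trans e
  left_inv e := by ext; simp
  right_inv e := by ext; simp

/-- An invertible matrix fixes `A` under conjugation iff it commutes with `A`, that is, iff it is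
`F[X]`-linear on `MatMod A`. -/
theorem stabilizerOrder_eq (A : Matrix m m F) :
    stabilizerOrder A = Nat.card (MatMod A ≃ₗ[F[X]] MatMod A) := by
  refine Nat.card_congr (Equiv.trans ?_ (matModLinearEquivEquiv A).symm)
  refine Equiv.subtypeEquiv (p := fun g => g ∈ MulAction.stabilizer (ConjAct (GL m F)) A)
    (ConjAct.ofConjAct.toEquiv.trans
      ((Matrix.GeneralLinearGroup.toLin.trans
        (LinearMap.GeneralLinearGroup.generalLinearEquiv F (m → F))).toEquiv.trans
        (linearEquivCongrRight (Module.AEval'.of (Matrix.toLin' A))))) fun g => ?_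
  obtain ⟨g, rfl⟩ := ConjAct.toConjAct.surjective g
  rw [MulAction.mem_stabilizer_iff, ConjAct.units_smul_def, ConjAct.ofConjAct_toConjAct,
    Units.mul_inv_eq_iff_eq_mul]
  have key : ∀ w, (ConjAct.ofConjAct.toEquiv.trans
      ((Matrix.GeneralLinearGroup.toLin.trans
        (LinearMap.GeneralLinearGroup.generalLinearEquiv F (m → F))).toEquiv.trans
        (linearEquivCongrRight (Module.AEval'.of (Matrix.toLin' A)))) (ConjAct.toConjAct g)) w =
      Module.AEval'.of (Matrix.toLin' A) ((g : Matrix m m F).mulVec w) := fun w => rfl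
  simp only [key, Module.AEval'.X_smul_of, EmbeddingLike.apply_eq_iff_eq, Matrix.toLin'_apply,
    Matrix.mulVec_mulVec]
  exact ⟨fun h w => by rw [h], fun h => (Matrix.ext_of_mulVec_single fun i => h _)⟩

theorem card_linearEquiv_eq_glOrder {F : Type*} [Field F] {N : Type*} [AddCommGroup N]
    [Module F N] [Module.Finite F N] (n : ℕ) (hN : Module.finrank F N = n) :
    Nat.card ((Fin n → F) ≃ₗ[F] N) = glOrder F n := by
  let v : N ≃ₗ[F] (Fin n → F) := (Module.finBasisOfFinrankEq F N hN).equivFun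
  exact (Nat.card_congr ((Matrix.GeneralLinearGroup.toLin.trans
    (LinearMap.GeneralLinearGroup.generalLinearEquiv F (Fin n → F))).toEquiv.trans
      (linearEquivCongrRight v.symm))).symm

/-- An `F`-linear isomorphism with column vectors determines the matrix of `X`. -/
noncomputable def sigmaMatModLinearEquiv :
    (Σ A : Matrix m m F, MatMod A ≃ₗ[F[X]] N) ≃ ((m → F) ≃ₗ[F] N) where
  toFun p := (matModLinearEquivEquiv p.1 p.2).1
  invFun e :=
    ⟨LinearMap.toMatrix' (e.symm.toLinearMap ∘ₗ Algebra.lsmul F F N (X : F[X]) ∘ₗ e.toLinearMap),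
      (matModLinearEquivEquiv _).symm ⟨e, fun w => by
        rw [← Matrix.toLin'_apply, Matrix.toLin'_toMatrix']; simp⟩⟩
  left_inv := by
    rintro ⟨A, e⟩
    obtain ⟨⟨e, he⟩, rfl⟩ := (matModLinearEquivEquiv A).symm.surjective e
    have hA : A = LinearMap.toMatrix'
        (e.symm.toLinearMap ∘ₗ Algebra.lsmul F F N (X : F[X]) ∘ₗ e.toLinearMap) := by
      apply Matrix.toLin'.injective
      ext1 w
      rw [Matrix.toLin'_toMatrix']
      ext i
      simp [← he]
    subst hA
    rfl
  right_inv e := rfl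

/-- The number of matrices whose module is isomorphic to `N`, times the number of automorphisms
of `N`, is the order of the general linear group. -/
theorem card_matMod_mul_card_aut [Finite F] [Module.Finite F N] (n : ℕ)
    (hN : Module.finrank F N = n) :
    Nat.card {A : Matrix (Fin n) (Fin n) F // Nonempty (MatMod A ≃ₗ[F[X]] N)} *
      Nat.card (N ≃ₗ[F[X]] N) = glOrder F n := by
  rw [← card_linearEquiv_eq_glOrder n hN, ← Nat.card_congr sigmaMatModLinearEquiv, ← Nat.card_prod]
  -- One chosen isomorphism for each admissible matrix identifies all its isomorphisms to `N` with
  -- automorphisms of `N`.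
  refine Nat.card_congr ⟨fun p => ⟨p.1.1, p.1.2.some.trans p.2⟩,
    fun p => ⟨⟨p.1, ⟨p.2⟩⟩, (Nonempty.intro p.2).some.symm.trans p.2⟩, ?_, ?_⟩
  · rintro ⟨⟨A, hA⟩, e⟩
    ext
    · rfl
    · simp
  · rintro ⟨A, e⟩
    simp only [Sigma.mk.injEq, heq_eq_eq, true_and]
    ext
    simp

end MatrixModules

/-! ### Companion matrices and cyclic modules -/

section Cyclic

variable {F : Type*} [Field F]

/-- The basis of powers of `X` of a cyclic module. -/
noncomputable def cycBasis {f : F[X]} (hf : f.Monic) :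
    Module.Basis (Fin f.natDegree) F (Cyc f) :=
  AdjoinRoot.powerBasisAux' hf

theorem cycBasis_apply {f : F[X]} (hf : f.Monic) (j : Fin f.natDegree) :
    cycBasis hf j = Ideal.Quotient.mk (Ideal.span {f}) (X ^ (j : ℕ)) := by
  have := (AdjoinRoot.powerBasis' hf).basis_eq_pow j
  exact this

theorem X_smul_cycBasis {f : F[X]} (hf : f.Monic) (j : Fin f.natDegree) :
    (X : F[X]) • cycBasis hf j = ∑ i, companion f i j • cycBasis hf i := by
  simp only [cycBasis_apply, companion, Matrix.of_apply]
  have h1 : (X : F[X]) • Ideal.Quotient.mk (Ideal.span {f}) (X ^ (j : ℕ)) =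
      Ideal.Quotient.mk (Ideal.span {f}) (X ^ ((j : ℕ) + 1)) := by
    rw [pow_succ', map_mul]; rfl
  rw [h1]
  split_ifs with h
  -- The last column: `f = 0` in the quotient expresses the leading power of `X` through the lower
  -- ones.
  · have h2 := hf.as_sum
    have h3 : Ideal.Quotient.mk (Ideal.span {f}) f = 0 :=
      Ideal.Quotient.eq_zero_iff_mem.2 (Ideal.mem_span_singleton_self f)
    have h4 := (congrArg (Ideal.Quotient.mk (Ideal.span {f})) h2).symm.trans h3
    rw [map_add, ← Fin.sum_univ_eq_sum_range
      (fun i => C (f.coeff i) * X ^ i), map_sum] at h4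
    rw [h, eq_neg_of_add_eq_zero_left h4, ← Finset.sum_neg_distrib]
    refine Fintype.sum_congr _ _ fun i => ?_
    rw [neg_smul, C_mul']
    rfl
  · have hj : (j : ℕ) + 1 < f.natDegree := lt_of_le_of_ne j.2 h
    rw [Finset.sum_eq_single ⟨(j : ℕ) + 1, hj⟩]
    · simp
    · intro i _ hi
      rw [if_neg fun h' => hi (Fin.ext h')]
      exact zero_smul F _
    · simp

theorem matMod_directSumCompanion {ι : Type*} [Fintype ι] [DecidableEq ι] (f : ι → F[X])
    (hf : ∀ j, (f j).Monic) :
    Nonempty (MatMod (directSumCompanion f) ≃ₗ[F[X]] Π j, Cyc (f j)) := by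
  refine ⟨matModEquivOfBasis (Pi.basis fun j => cycBasis (hf j)) _ ?_⟩
  rintro ⟨j, a⟩
  rw [Fintype.sum_sigma, Finset.sum_eq_single j]
  · simp only [Pi.basis_apply, directSumCompanion, Matrix.blockDiagonal'_apply_eq]
    rw [← Pi.single_smul, X_smul_cycBasis, ← LinearMap.single_apply (R := F)]
    simp
  · intro i _ hi
    simp only [directSumCompanion, Matrix.blockDiagonal'_apply_ne _ _ _ hi]
    exact Finset.sum_eq_zero fun x _ => funext fun k => zero_smul F (_ : Cyc (f k))
  · simp

/-- A basis in which `A` becomes a given matrix is the same as an isomorphism between the modules of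
the two matrices. -/
theorem hasPrimarySummands_iff {n : ℕ} (A : Matrix (Fin n) (Fin n) F) (k : ℕ) :
    HasPrimarySummands A k ↔ ∃ (φ : Fin k → F[X]) (m : Fin k → ℕ),
      (∀ j, (φ j).Monic ∧ Irreducible (φ j) ∧ 1 ≤ m j) ∧
      Nonempty (MatMod A ≃ₗ[F[X]] Π j, Cyc (φ j ^ m j)) := by
  refine exists_congr fun φ => exists_congr fun m => and_congr_right fun h => ?_
  obtain ⟨e⟩ := matMod_directSumCompanion (fun j => φ j ^ m j) fun j => (h j).1.pow _
  constructor
  · rintro ⟨v, hv⟩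
    refine ⟨(matModEquivOfBasis (v.map (Module.AEval'.of (Matrix.toLin' A)))
      (directSumCompanion fun j => φ j ^ m j) fun j => ?_).symm.trans e⟩
    rw [← hv, Module.Basis.map_apply, Module.AEval'.X_smul_of]
    simp only [Module.Basis.map_apply, ← map_smul, ← map_sum, LinearMap.toMatrix_apply,
      Module.Basis.sum_repr]
  · rintro ⟨e'⟩
    let g := e.trans e'.symm
    let v := (Pi.basisFun F _).map ((matModLinearEquivEquiv _ g).1.trans
      (Module.AEval'.of (Matrix.toLin' A)).symm)
    refine ⟨v, ?_⟩
    ext i j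
    have h1 := (matModLinearEquivEquiv _ g).2 (Pi.single j 1)
    have h2 : Matrix.toLin' A (v j) = (matModLinearEquivEquiv _ g).1.trans
        (Module.AEval'.of (Matrix.toLin' A)).symm
          ((directSumCompanion fun j => φ j ^ m j).mulVec (Pi.single j 1)) := by
      rw [LinearEquiv.trans_apply, h1, Module.AEval'.of_symm_X_smul]
      simp [v]
    rw [LinearMap.toMatrix_apply, h2]
    simp [v]

end Cyclic

/-! ### Automorphisms of a product without cross homomorphisms -/

section Pi

variable {R : Type*} [Ring R] {ι : Type*} [Finite ι] {M : ι → Type*}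
  [∀ i, AddCommGroup (M i)] [∀ i, Module R (M i)]

theorem linearMap_pi_apply_of_hom_eq_zero [DecidableEq ι]
    (h : ∀ i j, i ≠ j → ∀ f : M i →ₗ[R] M j, f = 0)
    (e : (Π i, M i) →ₗ[R] Π i, M i) (w : Π i, M i) (j : ι) :
    e w j = e (Pi.single j (w j)) j := by
  have := Fintype.ofFinite ι
  conv_lhs => rw [← Finset.univ_sum_single w, map_sum, Finset.sum_apply]
  refine Finset.sum_eq_single j (fun i _ hi => ?_) (by simp)
  exact LinearMap.congr_fun (h i j hi (LinearMap.proj j ∘ₗ e ∘ₗ LinearMap.single R M i)) (w i)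

/-- If there are no non-zero homomorphisms between different factors, then the automorphisms of
a finite product are the families of automorphisms of the factors. -/
noncomputable def autPiEquiv (h : ∀ i j, i ≠ j → ∀ f : M i →ₗ[R] M j, f = 0) :
    ((Π i, M i) ≃ₗ[R] Π i, M i) ≃ Π i, (M i ≃ₗ[R] M i) := by
  classical
  have key := fun e : (Π i, M i) ≃ₗ[R] Π i, M i =>
    linearMap_pi_apply_of_hom_eq_zero h e.toLinearMap
  refine ⟨fun e i => LinearEquiv.ofLinearMap
      (LinearMap.proj i ∘ₗ e.toLinearMap ∘ₗ LinearMap.single R M i)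
      (LinearMap.proj i ∘ₗ e.symm.toLinearMap ∘ₗ LinearMap.single R M i) ?_ ?_,
    fun e => LinearEquiv.piCongrRight e, fun e => ?_, fun e => ?_⟩
  · ext1 w
    have := key e (e.symm (Pi.single i w)) i
    simpa using this.symm
  · ext1 w
    have := key e.symm (e (Pi.single i w)) i
    simpa using this.symm
  · ext w i
    exact (key e w i).symm
  · ext i w
    simp

end Pi

/-! ### Torsion counts, uniqueness of the primary type, invertibility -/

section Cyclic

variable {F : Type*} [Field F]

theorem cyc_smul_self (f : F[X]) (w : Cyc f) : f • w = 0 := by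
  obtain ⟨p, rfl⟩ := Ideal.Quotient.mk_surjective w
  exact Ideal.Quotient.eq_zero_iff_mem.2 (Ideal.mul_mem_right _ _ (Ideal.mem_span_singleton_self f))

theorem cyc_smul_of_dvd {f g : F[X]} (h : f ∣ g) (w : Cyc f) : g • w = 0 := by
  obtain ⟨r, rfl⟩ := h
  rw [mul_comm, mul_smul, cyc_smul_self, smul_zero]

theorem smul_eq_zero_of_isCoprime {N : Type*} [AddCommGroup N] [Module F[X] N] {f g : F[X]}
    (h : IsCoprime f g) {w : N} (hf : f • w = 0) (hg : g • w = 0) : w = 0 := by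
  obtain ⟨a, b, hab⟩ := h
  rw [← one_smul F[X] w, ← hab, add_smul, mul_smul, mul_smul, hf, hg, smul_zero, smul_zero,
    add_zero]

theorem card_cyc [Finite F] {f : F[X]} (hf : f.Monic) :
    Nat.card (Cyc f) = Nat.card F ^ f.natDegree := by
  have := Module.Finite.of_basis (cycBasis hf)
  rw [Module.natCard_eq_pow_finrank (K := F), finrank_quotient_span_eq_natDegree]

/-- Multiplication by `h` embeds `Cyc g` into `Cyc (h * g)` with image the `g`-torsion. -/
theorem card_cyc_torsion_mul {g h : F[X]} (hg : g ≠ 0) (hh : h ≠ 0) :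
    Nat.card {w : Cyc (h * g) // g • w = 0} = Nat.card (Cyc g) := by
  have hle : Ideal.span {g} ≤
      Submodule.comap (LinearMap.mulLeft F[X] h) (Ideal.span {h * g}) := by
    rw [Ideal.span_singleton_le_iff_mem]
    exact Ideal.mem_span_singleton_self _
  let u : Cyc g →ₗ[F[X]] Cyc (h * g) := Submodule.mapQ _ _ (LinearMap.mulLeft F[X] h) hle
  have hu : ∀ w, g • u w = 0 := fun w => by rw [← map_smul, cyc_smul_self, map_zero]
  refine (Nat.card_congr (Equiv.ofBijective
    (fun w => (⟨u w, hu w⟩ : {w : Cyc (h * g) // g • w = 0})) ⟨?_, ?_⟩)).symm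
  · intro a b hab
    have h1 : u (a - b) = 0 := by
      rw [map_sub, sub_eq_zero]
      exact congrArg Subtype.val hab
    obtain ⟨p, hp⟩ := Ideal.Quotient.mk_surjective (a - b)
    rw [← hp] at h1
    have h2 : h * g ∣ h * p :=
      Ideal.mem_span_singleton.1 (Ideal.Quotient.eq_zero_iff_mem.1 h1)
    have h3 := (mul_dvd_mul_iff_left hh).1 h2
    rw [← sub_eq_zero, ← hp]
    exact Ideal.Quotient.eq_zero_iff_mem.2 (Ideal.mem_span_singleton.2 h3)
  · rintro ⟨w, hw⟩
    obtain ⟨p, rfl⟩ := Ideal.Quotient.mk_surjective w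
    have h1 : h * g ∣ g * p := Ideal.mem_span_singleton.1 (Ideal.Quotient.eq_zero_iff_mem.1 hw)
    rw [mul_comm h g, mul_dvd_mul_iff_left hg] at h1
    obtain ⟨r, rfl⟩ := h1
    exact ⟨Ideal.Quotient.mk _ r, rfl⟩

theorem card_cyc_pow_torsion [Finite F] {φ ψ : F[X]} (hφ : φ.Monic) (hφ' : Irreducible φ)
    (hψ : ψ.Monic) (hψ' : Irreducible ψ) (m i : ℕ) [Decidable (φ = ψ)] :
    Nat.card {w : Cyc (φ ^ m) // ψ ^ i • w = 0} =
      Nat.card F ^ (ψ.natDegree * if φ = ψ then min i m else 0) := by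
  split_ifs with h
  · subst h
    rcases le_total i m with him | him
    · obtain ⟨l, rfl⟩ := Nat.exists_eq_add_of_le' him
      rw [pow_add, card_cyc_torsion_mul (pow_ne_zero _ hφ.ne_zero)
        (pow_ne_zero _ hφ.ne_zero), card_cyc (hφ.pow _),
        min_eq_left him, natDegree_pow, mul_comm]
    · rw [min_eq_right him, mul_comm, ← natDegree_pow, ← card_cyc (hφ.pow _)]
      exact Nat.card_congr (Equiv.subtypeUnivEquiv fun w => cyc_smul_of_dvd (pow_dvd_pow _ him) w)
  · rw [mul_zero, pow_zero, Nat.card_eq_one_iff_unique]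
    refine ⟨⟨fun a b => Subtype.ext ?_⟩, ⟨⟨0, smul_zero _⟩⟩⟩
    have hc : IsCoprime (φ ^ m) (ψ ^ i) := by
      refine IsCoprime.pow ((hφ'.coprime_iff_not_dvd).2 fun hd => h ?_)
      exact eq_of_monic_of_associated hφ hψ (hφ'.associated_of_dvd hψ' hd)
    rw [smul_eq_zero_of_isCoprime hc (cyc_smul_self _ _) a.2,
      smul_eq_zero_of_isCoprime hc (cyc_smul_self _ _) b.2]

theorem card_pi_cyc_torsion [Finite F] [DecidableEq F[X]] {ι : Type*} [Fintype ι]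
    (φ : ι → F[X]) (m : ι → ℕ) (hφ : ∀ j, (φ j).Monic ∧ Irreducible (φ j))
    {ψ : F[X]} (hψ : ψ.Monic) (hψ' : Irreducible ψ) (i : ℕ) :
    Nat.card {w : Π j, Cyc (φ j ^ m j) // ψ ^ i • w = 0} =
      Nat.card F ^ (ψ.natDegree * ∑ j, if φ j = ψ then min i (m j) else 0) := by
  rw [Finset.mul_sum, ← Finset.prod_pow_eq_pow_sum]
  simp_rw [← fun j => card_cyc_pow_torsion (hφ j).1 (hφ j).2 hψ hψ' (m j) i]
  rw [← Nat.card_pi]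
  exact Nat.card_congr ((Equiv.subtypeEquivRight fun w => funext_iff).trans
    (Equiv.subtypePiEquivPi (p := fun j (w : Cyc (φ j ^ m j)) => ψ ^ i • w = 0)))

/-- The second difference of `min · l` at `i` is `-1` if `l = i` and `0` otherwise, so the torsion
exponents recover the multiplicities. The bound `1 ≤ i` keeps `i - 1` from truncating. -/
theorem card_add_sum_min {κ α : Type*} [Fintype κ] [DecidableEq α] (θ : κ → α) (l : κ → ℕ)
    (a : α) {i : ℕ} (hi : 1 ≤ i) :
    Nat.card {j // θ j = a ∧ l j = i} + (∑ j, if θ j = a then min (i - 1) (l j) else 0) +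
      (∑ j, if θ j = a then min (i + 1) (l j) else 0) =
    2 * ∑ j, if θ j = a then min i (l j) else 0 := by
  rw [Nat.card_eq_fintype_card, Fintype.card_subtype, Finset.card_filter, Finset.mul_sum,
    ← Finset.sum_add_distrib, ← Finset.sum_add_distrib]
  refine Finset.sum_congr rfl fun j _ => ?_
  by_cases h1 : θ j = a <;> by_cases h2 : l j = i <;> simp [h1, h2] <;> omega

/-- The multiplicity of each summand of a primary decomposition is determined by the module. -/
theorem card_primary_summand_eq [Finite F] {ι ι' : Type*} [Fintype ι] [Fintype ι']
    {φ : ι → F[X]} {m : ι → ℕ} {φ' : ι' → F[X]} {m' : ι' → ℕ}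
    (hφ : ∀ j, (φ j).Monic ∧ Irreducible (φ j)) (hφ' : ∀ j, (φ' j).Monic ∧ Irreducible (φ' j))
    (e : (Π j, Cyc (φ j ^ m j)) ≃ₗ[F[X]] Π j, Cyc (φ' j ^ m' j))
    {ψ : F[X]} (hψ : ψ.Monic) (hψ' : Irreducible ψ) {i : ℕ} (hi : 1 ≤ i) :
    Nat.card {j // φ j = ψ ∧ m j = i} = Nat.card {j // φ' j = ψ ∧ m' j = i} := by
  classical
  have key : ∀ a, (∑ j, if φ j = ψ then min a (m j) else 0) =
      ∑ j, if φ' j = ψ then min a (m' j) else 0 := by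
    intro a
    have h1 : Nat.card {w : Π j, Cyc (φ j ^ m j) // ψ ^ a • w = 0} =
        Nat.card {w : Π j, Cyc (φ' j ^ m' j) // ψ ^ a • w = 0} :=
      Nat.card_congr (e.toEquiv.subtypeEquiv fun w => by
        rw [LinearEquiv.coe_toEquiv, ← map_smul, LinearEquiv.map_eq_zero_iff])
    rw [card_pi_cyc_torsion _ _ hφ hψ hψ', card_pi_cyc_torsion _ _ hφ' hψ hψ'] at h1
    exact Nat.eq_of_mul_eq_mul_left hψ'.natDegree_pos
      (Nat.pow_right_injective (Finite.one_lt_card) h1)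
  have h1 := card_add_sum_min φ m ψ hi
  have h2 := card_add_sum_min φ' m' ψ hi
  rw [key, key, key] at h1
  omega

theorem hom_eq_zero_of_isCoprime {N N' : Type*} [AddCommGroup N] [AddCommGroup N'] [Module F[X] N]
    [Module F[X] N'] {f g : F[X]} (h : IsCoprime f g) (hf : ∀ w : N, f • w = 0)
    (hg : ∀ w : N', g • w = 0) (u : N →ₗ[F[X]] N') : u = 0 := by
  ext w
  exact smul_eq_zero_of_isCoprime h (by rw [← map_smul, hf, map_zero]) (hg _)

/-- Invertibility means that `X` acts injectively, which can be tested on each cyclic factor: `X` is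
coprime to `φ j ^ m j` unless `φ j = X`. -/
theorem isUnit_iff_of_matMod_equiv {n : Type*} [Fintype n] [DecidableEq n] (A : Matrix n n F)
    {ι : Type*} {φ : ι → F[X]} {m : ι → ℕ}
    (hφ : ∀ j, (φ j).Monic ∧ Irreducible (φ j) ∧ 1 ≤ m j)
    (e : MatMod A ≃ₗ[F[X]] Π j, Cyc (φ j ^ m j)) : IsUnit A ↔ ∀ j, φ j ≠ X := by
  classical
  have h1 : IsUnit A ↔ ∀ w : MatMod A, (X : F[X]) • w = 0 → w = 0 := by
    rw [← Matrix.mulVec_injective_iff_isUnit, ← Matrix.coe_mulVecLin, ← LinearMap.ker_eq_bot,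
      LinearMap.ker_eq_bot']
    refine (Module.AEval'.of (Matrix.toLin' A)).toEquiv.forall_congr fun w => ?_
    rw [LinearEquiv.coe_toEquiv, Module.AEval'.X_smul_of, LinearEquiv.map_eq_zero_iff,
      LinearEquiv.map_eq_zero_iff, Matrix.toLin'_apply']
  have h2 : (∀ w : MatMod A, (X : F[X]) • w = 0 → w = 0) ↔
      ∀ w : Π j, Cyc (φ j ^ m j), (X : F[X]) • w = 0 → w = 0 := by
    refine e.toEquiv.forall_congr fun w => ?_
    rw [LinearEquiv.coe_toEquiv, ← map_smul, LinearEquiv.map_eq_zero_iff,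
      LinearEquiv.map_eq_zero_iff]
  rw [h1, h2]
  constructor
  · intro h j hj
    -- The class of `X ^ (m j - 1)` is a non-zero element killed by `X`.
    let w : Cyc (φ j ^ m j) := Ideal.Quotient.mk _ (X ^ (m j - 1))
    have hw : w ≠ 0 := by
      intro h0
      have := Ideal.mem_span_singleton.1 (Ideal.Quotient.eq_zero_iff_mem.1 h0)
      rw [hj, pow_dvd_pow_iff X_ne_zero not_isUnit_X] at this
      have := (hφ j).2.2
      omega
    have hX : (X : F[X]) • w = 0 := by
      refine Ideal.Quotient.eq_zero_iff_mem.2 (Ideal.mem_span_singleton.2 ?_)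
      change _ ∣ X * X ^ (m j - 1)
      rw [← pow_succ', Nat.sub_add_cancel (hφ j).2.2, hj]
    apply hw
    have := h (Pi.single j w) (by rw [← Pi.single_smul, hX, Pi.single_zero])
    simpa using this
  · intro h w hw
    funext j
    refine smul_eq_zero_of_isCoprime (f := φ j ^ m j) (g := X) ?_ (cyc_smul_self _ _)
      (congrFun hw j)
    refine IsCoprime.pow_left (((hφ j).2.1.coprime_iff_not_dvd).2 fun hd => h j ?_)
    exact eq_of_monic_of_associated (hφ j).1 monic_X
      ((hφ j).2.1.associated_of_dvd irreducible_X hd)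

end Cyclic

/-! ### Primary modules indexed by families of partitions -/

section Primary

variable {F : Type*} [Field F]

/-- The index set of the parts of the partition `b`. -/
abbrev PartIdx (b : ℕ+ →₀ ℕ) : Type := Σ i : b.support, Fin (b i)

/-- The `φ`-primary module of type `b`. -/
abbrev PrimMod (φ : F[X]) (b : ℕ+ →₀ ℕ) : Type _ :=
  Π j : PartIdx b, Cyc (φ ^ ((j.1 : ℕ+) : ℕ))

/-- The direct sum of the `θ a`-primary modules of type `β a`. -/
abbrev TotMod {κ : Type*} (θ : κ → F[X]) (β : κ → ℕ+ →₀ ℕ) : Type _ :=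
  Π a, PrimMod (θ a) (β a)

theorem card_aut_congr {R M N : Type*} [Ring R] [AddCommGroup M] [AddCommGroup N] [Module R M]
    [Module R N] (e : M ≃ₗ[R] N) : Nat.card (M ≃ₗ[R] M) = Nat.card (N ≃ₗ[R] N) :=
  Nat.card_congr ((linearEquivCongrLeft e).trans (linearEquivCongrRight e))

theorem centralizerOrder_eq {φ : F[X]} (hφ : φ.Monic) (b : ℕ+ →₀ ℕ) :
    centralizerOrder φ b = Nat.card (PrimMod φ b ≃ₗ[F[X]] PrimMod φ b) := by
  obtain ⟨e⟩ := matMod_directSumCompanion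
    (fun j : PartIdx b => φ ^ ((j.1 : ℕ+) : ℕ)) fun j => hφ.pow _
  rw [centralizerOrder, stabilizerOrder_eq]
  exact card_aut_congr e

theorem primMod_smul_eq_zero (φ : F[X]) (b : ℕ+ →₀ ℕ) :
    ∃ K, ∀ w : PrimMod φ b, φ ^ K • w = 0 := by
  refine ⟨∑ j : PartIdx b, ((j.1 : ℕ+) : ℕ), fun w => funext fun j => ?_⟩
  exact cyc_smul_of_dvd (pow_dvd_pow _ (Finset.single_le_sum
    (f := fun j : PartIdx b => ((j.1 : ℕ+) : ℕ)) (fun _ _ => Nat.zero_le _) (Finset.mem_univ j))) _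

theorem card_partIdx_fiber (b : ℕ+ →₀ ℕ) (i : ℕ+) :
    Nat.card {j : PartIdx b // (j.1 : ℕ+) = i} = b i := by
  by_cases hi : i ∈ b.support
  · rw [← Nat.card_fin (b i)]
    refine Nat.card_congr ⟨fun j => Fin.cast (by rw [j.2]) j.1.2, fun k => ⟨⟨⟨i, hi⟩, k⟩, rfl⟩,
      ?_, fun k => rfl⟩
    rintro ⟨⟨⟨_, _⟩, k⟩, rfl⟩
    rfl
  · rw [Finsupp.notMem_support_iff.1 hi, Nat.card_eq_zero]
    exact Or.inl ⟨fun j => hi (j.2 ▸ j.1.1.2)⟩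

theorem card_sigma_partIdx_fiber {κ : Type*} {θ : κ → F[X]} (hinj : Function.Injective θ)
    (β : κ → ℕ+ →₀ ℕ) (a : κ)
    (i : ℕ+) :
    Nat.card {p : Σ a, PartIdx (β a) // θ p.1 = θ a ∧ ((p.2.1 : ℕ+) : ℕ) = (i : ℕ)} = β a i := by
  rw [← card_partIdx_fiber]
  refine (Nat.card_congr (Equiv.ofBijective (fun j => ⟨⟨a, j.1⟩, rfl, by rw [j.2]⟩) ⟨?_, ?_⟩)).symm
  · rintro ⟨j, hj⟩ ⟨j', hj'⟩ h
    simpa using h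
  · rintro ⟨⟨a', j⟩, h1, h2⟩
    obtain rfl := hinj h1
    exact ⟨⟨j, PNat.coe_injective h2⟩, rfl⟩

section Total

variable {κ : Type*} [Fintype κ] {θ : κ → F[X]}

theorem card_aut_totMod (hθ : ∀ a, (θ a).Monic ∧ Irreducible (θ a))
    (hinj : Function.Injective θ) (β : κ → ℕ+ →₀ ℕ) :
    Nat.card (TotMod θ β ≃ₗ[F[X]] TotMod θ β) = ∏ a, centralizerOrder (θ a) (β a) := by
  have h : ∀ a b, a ≠ b → ∀ f : PrimMod (θ a) (β a) →ₗ[F[X]] PrimMod (θ b) (β b), f = 0 := by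
    intro a b hab f
    obtain ⟨K, hK⟩ := primMod_smul_eq_zero (θ a) (β a)
    obtain ⟨L, hL⟩ := primMod_smul_eq_zero (θ b) (β b)
    refine hom_eq_zero_of_isCoprime (IsCoprime.pow ?_) hK hL f
    refine ((hθ a).2.coprime_iff_not_dvd).2 fun hd => hab (hinj ?_)
    exact eq_of_monic_of_associated (hθ a).1 (hθ b).1 ((hθ a).2.associated_of_dvd (hθ b).2 hd)
  rw [Nat.card_congr (autPiEquiv h), Nat.card_pi]
  exact Finset.prod_congr rfl fun a _ => (centralizerOrder_eq (hθ a).1 _).symm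

/-- The module `TotMod θ β` as a single product of cyclic modules. -/
noncomputable def totModEquiv (θ : κ → F[X]) (β : κ → ℕ+ →₀ ℕ) :
    TotMod θ β ≃ₗ[F[X]] Π p : (Σ a, PartIdx (β a)), Cyc (θ p.1 ^ ((p.2.1 : ℕ+) : ℕ)) :=
  (LinearEquiv.piCurry F[X]
    (fun a (j : PartIdx (β a)) => Cyc (θ a ^ ((j.1 : ℕ+) : ℕ)))).symm

theorem card_partIdx (b : ℕ+ →₀ ℕ) : Fintype.card (PartIdx b) = parts b := by
  simp only [Fintype.card_sigma, Fintype.card_fin]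
  exact Finset.sum_coe_sort b.support fun i => b i

theorem sum_partIdx (b : ℕ+ →₀ ℕ) : ∑ j : PartIdx b, ((j.1 : ℕ+) : ℕ) = size b := by
  simp only [Fintype.sum_sigma, Finset.sum_const, Finset.card_univ, Fintype.card_fin,
    smul_eq_mul, mul_comm (b _)]
  exact Finset.sum_coe_sort b.support fun i => (i : ℕ) * b i

theorem finite_totMod (hθ : ∀ a, (θ a).Monic) (β : κ → ℕ+ →₀ ℕ) :
    Module.Finite F (TotMod θ β) := by
  have := fun a (j : PartIdx (β a)) =>
    Module.Finite.of_basis (cycBasis ((hθ a).pow ((j.1 : ℕ+) : ℕ)))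
  infer_instance

theorem finrank_totMod (hθ : ∀ a, (θ a).Monic) (β : κ → ℕ+ →₀ ℕ) :
    Module.finrank F (TotMod θ β) = ∑ a, size (β a) * (θ a).natDegree := by
  have := fun a (j : PartIdx (β a)) =>
    Module.Finite.of_basis (cycBasis ((hθ a).pow ((j.1 : ℕ+) : ℕ)))
  have := fun a (j : PartIdx (β a)) =>
    Module.Free.of_basis (cycBasis ((hθ a).pow ((j.1 : ℕ+) : ℕ)))
  rw [Module.finrank_pi_fintype]
  refine Finset.sum_congr rfl fun a _ => ?_
  rw [Module.finrank_pi_fintype, ← sum_partIdx, Finset.sum_mul]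
  refine Finset.sum_congr rfl fun j _ => ?_
  rw [finrank_quotient_span_eq_natDegree, natDegree_pow]

/-- The module determines the multiplicities. -/
theorem eq_of_totMod_equiv [Finite F] (hθ : ∀ a, (θ a).Monic ∧ Irreducible (θ a))
    (hinj : Function.Injective θ) {β β' : κ → ℕ+ →₀ ℕ}
    (e : TotMod θ β ≃ₗ[F[X]] TotMod θ β') : β = β' := by
  funext a
  ext i
  rw [← card_sigma_partIdx_fiber hinj β, ← card_sigma_partIdx_fiber hinj β']
  exact card_primary_summand_eq (fun p => hθ p.1) (fun p => hθ p.1)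
    (((totModEquiv θ β).symm.trans e).trans (totModEquiv θ β')) (hθ a).1 (hθ a).2 i.pos

theorem exists_equiv_of_card_fiber_eq {ι ι' L : Type*} [Finite ι] [Finite ι'] (l : ι → L)
    (l' : ι' → L) (h : ∀ c, Nat.card {j // l j = c} = Nat.card {j // l' j = c}) :
    ∃ e : ι ≃ ι', ∀ j, l' (e j) = l j := by
  have g := fun c => (Finite.card_eq.1 (h c)).some
  refine ⟨(Equiv.sigmaFiberEquiv l).symm.trans
    ((Equiv.sigmaCongrRight g).trans (Equiv.sigmaFiberEquiv l')), fun j => ?_⟩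
  exact (g (l j) ⟨j, rfl⟩).2

theorem nonempty_piCyc_equiv {ι ι' : Type*} (e : ι ≃ ι') (f : ι → F[X]) (f' : ι' → F[X])
    (h : ∀ j, f' (e j) = f j) : Nonempty ((Π j, Cyc (f j)) ≃ₗ[F[X]] Π j, Cyc (f' j)) := by
  obtain rfl : f = fun j => f' (e j) := funext fun j => (h j).symm
  exact ⟨LinearEquiv.piCongrLeft F[X] (fun j => Cyc (f' j)) e⟩

/-- Every finite family of primary cyclic modules with primes among the `θ a` is of the form
`TotMod θ β`. -/
theorem exists_totMod_equiv (hinj : Function.Injective θ) {ι : Type*} [Fintype ι] (c : ι → κ)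
    (m : ι → ℕ) (hm : ∀ j, 1 ≤ m j) :
    ∃ β : κ → ℕ+ →₀ ℕ, Fintype.card ι = ∑ a, parts (β a) ∧
      Nonempty ((Π j, Cyc (θ (c j) ^ m j)) ≃ₗ[F[X]] TotMod θ β) := by
  classical
  let m' : ι → ℕ+ := fun j => ⟨m j, hm j⟩
  -- `β a i` counts the factors with prime `θ a` and exponent `i`.
  let β : κ → ℕ+ →₀ ℕ := fun a => ∑ j with c j = a, Finsupp.single (m' j) 1
  have hβ : ∀ a i, β a i = Nat.card {j // c j = a ∧ m' j = i} := by
    intro a i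
    rw [Nat.card_eq_fintype_card, Fintype.card_subtype, Finsupp.finsetSum_apply,
      ← Finset.filter_filter, Finset.card_filter]
    exact Finset.sum_congr rfl fun j _ => by rw [Finsupp.single_apply]
  obtain ⟨e, he⟩ := exists_equiv_of_card_fiber_eq (fun j => (c j, m' j))
    (fun p : Σ a, PartIdx (β a) => (p.1, (p.2.1 : ℕ+))) (by
      rintro ⟨a, i⟩
      simp only [Prod.mk.injEq]
      rw [← hβ, ← card_sigma_partIdx_fiber hinj β a i]
      refine Nat.card_congr (Equiv.subtypeEquivRight fun p => ?_)
      rw [hinj.eq_iff, PNat.coe_inj])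
  refine ⟨β, ?_, ?_⟩
  · rw [Fintype.card_congr e, Fintype.card_sigma]
    exact Finset.sum_congr rfl fun a _ => card_partIdx _
  · obtain ⟨g⟩ := nonempty_piCyc_equiv e (fun j => θ (c j) ^ m j)
      (fun p : Σ a, PartIdx (β a) => θ p.1 ^ ((p.2.1 : ℕ+) : ℕ)) fun j => by
        have := he j
        simp only [Prod.mk.injEq] at this
        exact congrArg₂ (fun a (i : ℕ+) => θ a ^ (i : ℕ)) this.1 this.2
    exact ⟨g.trans (totModEquiv θ β).symm⟩

theorem hasPrimarySummands_of_totMod_equiv (hθ : ∀ a, (θ a).Monic ∧ Irreducible (θ a)) {n : ℕ}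
    (A : Matrix (Fin n) (Fin n) F) (β : κ → ℕ+ →₀ ℕ) (e : MatMod A ≃ₗ[F[X]] TotMod θ β) :
    HasPrimarySummands A (∑ a, parts (β a)) := by
  have hc : Fintype.card (Σ a, PartIdx (β a)) = ∑ a, parts (β a) := by
    rw [Fintype.card_sigma]
    exact Finset.sum_congr rfl fun a _ => card_partIdx _
  let t := (Fintype.equivFinOfCardEq hc).symm
  refine (hasPrimarySummands_iff _ _).2
    ⟨fun j => θ (t j).1, fun j => (((t j).2.1 : ℕ+) : ℕ), fun j => ?_, ?_⟩
  · exact ⟨(hθ _).1, (hθ _).2, PNat.pos _⟩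
  · obtain ⟨g⟩ := nonempty_piCyc_equiv t
      (fun j => θ (t j).1 ^ (((t j).2.1 : ℕ+) : ℕ))
      (fun p : Σ a, PartIdx (β a) => θ p.1 ^ ((p.2.1 : ℕ+) : ℕ)) fun j => rfl
    exact ⟨(e.trans (totModEquiv θ β)).trans g.symm⟩

end Total

end Primary

/-! ### Counting invertible matrices by type -/

section Count

variable {F : Type*} [Field F]

theorem finite_size_le (n : ℕ) : {b : ℕ+ →₀ ℕ | size b ≤ n}.Finite := by
  -- If `b i ≠ 0`, then `i * b i ≤ n` bounds both `i` and `b i` by `n`; so `b` lies below the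
  -- function equal to `n` on `1, …, n`.
  refine (Set.finite_Iic (Finsupp.indicator ((Finset.range n).image Nat.succPNat)
    fun _ _ => n)).subset fun b hb i => ?_
  rcases Nat.eq_zero_or_pos (b i) with h0 | h0
  · exact h0 ▸ Nat.zero_le _
  have h1 : (i : ℕ) * b i ≤ n := le_trans (Finset.single_le_sum
    (f := fun i : ℕ+ => (i : ℕ) * b i) (fun _ _ => Nat.zero_le _)
    (Finsupp.mem_support_iff.2 h0.ne')) hb
  have h2 : i ∈ (Finset.range n).image Nat.succPNat := by
    refine Finset.mem_image.2 ⟨i.natPred, Finset.mem_range.2 ?_, PNat.succPNat_natPred i⟩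
    have := Nat.le_of_mul_le_mul_right (le_trans h1 (Nat.le_mul_of_pos_right n h0)) h0
    have := PNat.natPred_add_one i
    omega
  rw [Finsupp.indicator_of_mem h2]
  exact le_trans (Nat.le_mul_of_pos_left _ i.pos) h1

/-- The partitions of the integers up to `n`. -/
noncomputable def partitionsLE (n : ℕ) : Finset (ℕ+ →₀ ℕ) := (finite_size_le n).toFinset

theorem mem_partitionsLE {n : ℕ} {b : ℕ+ →₀ ℕ} : b ∈ partitionsLE n ↔ size b ≤ n := by
  simp [partitionsLE]

theorem finite_natDegree_le [Finite F] (n : ℕ) : {p : F[X] | p.natDegree ≤ n}.Finite := by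
  refine Set.Finite.of_injOn (f := fun p (i : Fin (n + 1)) => p.coeff i) (t := Set.univ)
    (fun _ _ => Set.mem_univ _) (fun p hp q hq h => ?_) Set.finite_univ
  ext i
  by_cases hi : i < n + 1
  · exact congrFun h ⟨i, hi⟩
  · have hp' : p.natDegree ≤ n := hp
    have hq' : q.natDegree ≤ n := hq
    rw [coeff_eq_zero_of_natDegree_lt (by omega), coeff_eq_zero_of_natDegree_lt (by omega)]

open Classical in
/-- The families of partitions, indexed by the primes `θ a`, of total size `n` with `k` parts. -/
noncomputable def partitionFamilies {κ : Type*} [Fintype κ] (θ : κ → F[X]) (n k : ℕ) :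
    Finset (κ → ℕ+ →₀ ℕ) :=
  (Fintype.piFinset fun _ => partitionsLE n).filter fun β =>
    ∑ a, size (β a) * (θ a).natDegree = n ∧ ∑ a, parts (β a) = k

theorem mem_partitionFamilies {κ : Type*} [Fintype κ] {θ : κ → F[X]}
    (hθ : ∀ a, Irreducible (θ a)) {n k : ℕ} {β : κ → ℕ+ →₀ ℕ} :
    β ∈ partitionFamilies θ n k ↔
      ∑ a, size (β a) * (θ a).natDegree = n ∧ ∑ a, parts (β a) = k := by
  simp only [partitionFamilies, Finset.mem_filter, Fintype.mem_piFinset, mem_partitionsLE,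
    and_iff_right_iff_imp]
  rintro ⟨h, -⟩ a
  rw [← h]
  exact le_trans (Nat.le_mul_of_pos_right _ (hθ a).natDegree_pos) (Finset.single_le_sum
    (f := fun a => size (β a) * (θ a).natDegree) (fun _ _ => Nat.zero_le _) (Finset.mem_univ a))

variable [Finite F] {κ : Type*} [Fintype κ] {θ : κ → F[X]}

theorem glOrder_pos (n : ℕ) : 0 < glOrder F n := by
  have : Finite (GL (Fin n) F) := inferInstance
  exact Nat.card_pos

/-- The number of matrices with given multiplicities. -/
theorem card_matMod_totMod_mul (hθ : ∀ a, (θ a).Monic ∧ Irreducible (θ a))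
    (hinj : Function.Injective θ) (β : κ → ℕ+ →₀ ℕ) {n : ℕ}
    (hn : ∑ a, size (β a) * (θ a).natDegree = n) :
    Nat.card {A : Matrix (Fin n) (Fin n) F // Nonempty (MatMod A ≃ₗ[F[X]] TotMod θ β)} *
      ∏ a, centralizerOrder (θ a) (β a) = glOrder F n := by
  have := finite_totMod (fun a => (hθ a).1) β
  rw [← card_aut_totMod hθ hinj]
  exact card_matMod_mul_card_aut n ((finrank_totMod (fun a => (hθ a).1) β).trans hn)

/-- The `q`-Stirling cycle number as a sum over families of partitions. -/
theorem cycleNumber_eq_sum (hθ : ∀ a, (θ a).Monic ∧ Irreducible (θ a) ∧ θ a ≠ X)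
    (hinj : Function.Injective θ) (n k : ℕ)
    (hsurj : ∀ φ : F[X], φ.Monic → Irreducible φ → φ ≠ X → φ.natDegree ≤ n → ∃ a, θ a = φ) :
    cycleNumber F n k = ∑ β ∈ partitionFamilies θ n k,
      Nat.card {A : Matrix (Fin n) (Fin n) F // Nonempty (MatMod A ≃ₗ[F[X]] TotMod θ β)} := by
  have hθ' : ∀ a, (θ a).Monic ∧ Irreducible (θ a) := fun a => ⟨(hθ a).1, (hθ a).2.1⟩
  have hmem : ∀ {β : κ → ℕ+ →₀ ℕ}, β ∈ partitionFamilies θ n k ↔ _ :=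
    mem_partitionFamilies fun a => (hθ a).2.1
  rw [← Finset.sum_coe_sort, ← Nat.card_sigma]
  have hunit : ∀ (β : κ → ℕ+ →₀ ℕ) (A : Matrix (Fin n) (Fin n) F),
      Nonempty (MatMod A ≃ₗ[F[X]] TotMod θ β) → IsUnit A := by
    rintro β A ⟨e⟩
    exact (isUnit_iff_of_matMod_equiv A (fun p => ⟨(hθ _).1, (hθ _).2.1, PNat.pos _⟩)
      (e.trans (totModEquiv θ β))).2 fun p => (hθ _).2.2
  have hsummands : ∀ β ∈ partitionFamilies θ n k, ∀ A : Matrix (Fin n) (Fin n) F,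
      Nonempty (MatMod A ≃ₗ[F[X]] TotMod θ β) → HasPrimarySummands A k := by
    rintro β hβ A ⟨e⟩
    rw [← (hmem.1 hβ).2]
    exact hasPrimarySummands_of_totMod_equiv hθ' A β e
  -- Forgetting `β` is injective because the module determines `β`, and surjective because `θ`
  -- covers every prime that can occur.
  refine (Nat.card_congr (Equiv.ofBijective (fun p => ⟨(hunit p.1 p.2.1 p.2.2).unit,
    hsummands p.1 p.1.2 p.2.1 p.2.2⟩) ⟨?_, ?_⟩)).symm
  · rintro ⟨⟨β, hβ⟩, A, hA⟩ ⟨⟨β', hβ'⟩, A', hA'⟩ h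
    have h' : A = A' := congrArg Units.val (congrArg Subtype.val h)
    subst h'
    obtain rfl : β = β' := eq_of_totMod_equiv hθ' hinj (hA.some.symm.trans hA'.some)
    rfl
  · rintro ⟨A, hA⟩
    obtain ⟨φ, m, hφ, ⟨e⟩⟩ := (hasPrimarySummands_iff _ _).1 hA
    have hX := (isUnit_iff_of_matMod_equiv _ hφ e).1 A.isUnit
    -- A prime occurring in a module of dimension `n` has degree at most `n`.
    have hdeg : ∀ j, (φ j).natDegree ≤ n := by
      intro j
      have := fun j => Module.Finite.of_basis (cycBasis ((hφ j).1.pow (m j)))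
      have := fun j => Module.Free.of_basis (cycBasis ((hφ j).1.pow (m j)))
      have h1 := ((Module.AEval'.of _).trans (e.restrictScalars F)).finrank_eq
      rw [Module.finrank_fin_fun, Module.finrank_pi_fintype] at h1
      rw [h1]
      refine le_trans ?_ (Finset.single_le_sum
        (f := fun j => Module.finrank F (Cyc (φ j ^ m j))) (fun _ _ => Nat.zero_le _)
        (Finset.mem_univ j))
      rw [finrank_quotient_span_eq_natDegree, natDegree_pow]
      exact Nat.le_mul_of_pos_left _ (hφ j).2.2
    choose c hc using fun j => hsurj (φ j) (hφ j).1 (hφ j).2.1 (hX j) (hdeg j)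
    obtain rfl : φ = fun j => θ (c j) := funext fun j => (hc j).symm
    obtain ⟨β, hk, ⟨g⟩⟩ := exists_totMod_equiv hinj c m fun j => (hφ j).2.2
    have hn := ((Module.AEval'.of _).trans ((e.trans g).restrictScalars F)).finrank_eq
    rw [Module.finrank_fin_fun, finrank_totMod fun a => (hθ a).1] at hn
    rw [Fintype.card_fin] at hk
    exact ⟨⟨⟨β, hmem.2 ⟨hn.symm, hk.symm⟩⟩, A, ⟨e.trans g⟩⟩, Subtype.ext (Units.ext rfl)⟩

theorem cycleNumber_div_glOrder (hθ : ∀ a, (θ a).Monic ∧ Irreducible (θ a) ∧ θ a ≠ X)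
    (hinj : Function.Injective θ) (n k : ℕ)
    (hsurj : ∀ φ : F[X], φ.Monic → Irreducible φ → φ ≠ X → φ.natDegree ≤ n → ∃ a, θ a = φ) :
    (cycleNumber F n k : ℚ) / glOrder F n = ∑ β ∈ partitionFamilies θ n k,
      ∏ a, (centralizerOrder (θ a) (β a) : ℚ)⁻¹ := by
  rw [cycleNumber_eq_sum hθ hinj n k hsurj, Nat.cast_sum, Finset.sum_div]
  refine Finset.sum_congr rfl fun β hβ => ?_
  have h1 := card_matMod_totMod_mul (fun a => ⟨(hθ a).1, (hθ a).2.1⟩) hinj β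
    ((mem_partitionFamilies fun a => (hθ a).2.1).1 hβ).1
  have h2 : (glOrder F n : ℚ) ≠ 0 := Nat.cast_ne_zero.2 (glOrder_pos n).ne'
  rw [← h1, Nat.cast_mul] at h2
  rw [← h1, Nat.cast_mul, Nat.cast_prod, Finset.prod_inv_distrib]
  rw [Nat.cast_prod] at h2
  field_simp [left_ne_zero_of_mul h2, right_ne_zero_of_mul h2]

end Count

/-! ### Coefficients of the sums and products -/

section Series

variable {F : Type*} [Field F]

/-- The exponent of the monomial `term φ b`. -/
noncomputable def termExp (φ : F[X]) (b : ℕ+ →₀ ℕ) : Fin 2 →₀ ℕ :=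
  Finsupp.single 0 (size b * φ.natDegree) + Finsupp.single 1 (parts b)

theorem term_eq_monomial (φ : F[X]) (b : ℕ+ →₀ ℕ) :
    term φ b = MvPowerSeries.monomial (termExp φ b) (centralizerOrder φ b : ℚ)⁻¹ := by
  rw [term, x, y, MvPowerSeries.X_pow_eq, MvPowerSeries.X_pow_eq,
    MvPowerSeries.monomial_mul_monomial, ← map_smul, termExp]
  simp

theorem hasSum_of_coeff {ι : Type*} {f : ι → MvPowerSeries (Fin 2) ℚ}
    {g : MvPowerSeries (Fin 2) ℚ} (s : (Fin 2 →₀ ℕ) → Finset ι)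
    (hs : ∀ d, ∀ i ∉ s d, MvPowerSeries.coeff d (f i) = 0)
    (hg : ∀ d, MvPowerSeries.coeff d g = ∑ i ∈ s d, MvPowerSeries.coeff d (f i)) :
    HasSum f g := by
  let _ : TopologicalSpace ℚ := ⊥
  refine MvPowerSeries.WithPiTopology.hasSum_iff_hasSum_coeff.2 fun d => ?_
  rw [hg]
  exact hasSum_sum_of_ne_finset_zero (hs d)

theorem hasProd_of_coeff {ι : Type*} {f : ι → MvPowerSeries (Fin 2) ℚ}
    {g : MvPowerSeries (Fin 2) ℚ} (h : ∀ d, ∃ s₀ : Finset ι, ∀ s, s₀ ⊆ s →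
      MvPowerSeries.coeff d (∏ i ∈ s, f i) = MvPowerSeries.coeff d g) :
    HasProd f g := by
  let _ : TopologicalSpace ℚ := ⊥
  refine (MvPowerSeries.WithPiTopology.tendsto_iff_coeff_tendsto _ _ _).2 fun d => ?_
  obtain ⟨s₀, hs₀⟩ := h d
  rw [SummationFilter.unconditional_filter]
  exact tendsto_const_nhds.congr' (Filter.eventually_atTop.2 ⟨s₀, fun s hs => (hs₀ s hs).symm⟩)

theorem t2Space_formalTopology : T2Space (MvPowerSeries (Fin 2) ℚ) := by
  let _ : TopologicalSpace ℚ := ⊥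
  have : DiscreteTopology ℚ := ⟨rfl⟩
  exact MvPowerSeries.WithPiTopology.instT2Space

theorem coeff_term_eq_zero {φ : F[X]} (hφ : Irreducible φ) {d : Fin 2 →₀ ℕ} {n : ℕ}
    (hd : d 0 ≤ n) {b : ℕ+ →₀ ℕ} (hb : b ∉ partitionsLE n) :
    MvPowerSeries.coeff d (term φ b) = 0 := by
  rw [term_eq_monomial, MvPowerSeries.coeff_monomial_ne]
  rintro rfl
  refine hb (mem_partitionsLE.2 (le_trans (Nat.le_mul_of_pos_right _ hφ.natDegree_pos) ?_))
  simpa [termExp] using hd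

theorem centralizerOrder_zero {φ : F[X]} (hφ : φ.Monic) : centralizerOrder φ 0 = 1 := by
  rw [centralizerOrder_eq hφ, Nat.card_eq_one_iff_unique]
  have : IsEmpty (PartIdx 0) := ⟨fun j => Finsupp.mem_support_iff.1 j.1.2 rfl⟩
  exact ⟨⟨fun e e' => LinearEquiv.ext fun w => Subsingleton.elim _ _⟩, ⟨LinearEquiv.refl _ _⟩⟩

theorem term_zero {φ : F[X]} (hφ : φ.Monic) : term φ 0 = 1 := by
  rw [term, centralizerOrder_zero hφ]
  simp [size, parts]

theorem coeff_sum_term {φ : F[X]} (hφ : Irreducible φ) {d : Fin 2 →₀ ℕ} {n : ℕ} (hd : d 0 ≤ n) :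
    MvPowerSeries.coeff d (∑ b ∈ partitionsLE n, term φ b) =
      ∑ b ∈ partitionsLE (d 0), MvPowerSeries.coeff d (term φ b) := by
  rw [map_sum]
  refine (Finset.sum_subset (fun b hb => ?_) fun b _ hb =>
    coeff_term_eq_zero hφ le_rfl hb).symm
  exact mem_partitionsLE.2 ((mem_partitionsLE.1 hb).trans hd)

/-- The sum of the terms `term φ b` over all partitions `b`. -/
noncomputable def termSeries (φ : F[X]) : MvPowerSeries (Fin 2) ℚ :=
  fun d => ∑ b ∈ partitionsLE (d 0), MvPowerSeries.coeff d (term φ b)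

theorem hasSum_term {φ : F[X]} (hφ : φ.Monic) (hφ' : Irreducible φ) :
    HasSum (fun b : {b : ℕ+ →₀ ℕ // b ≠ 0} => term φ b)
      (termSeries φ - 1) := by
  classical
  refine hasSum_of_coeff (fun d => (partitionsLE (d 0)).subtype (· ≠ 0)) (fun d b hb => ?_)
    fun d => ?_
  · exact coeff_term_eq_zero hφ' le_rfl fun h => hb (Finset.mem_subtype.2 h)
  · rw [Finset.sum_subtype_eq_sum_filter (s := partitionsLE (d 0)) (p := (· ≠ 0))
      (fun b => MvPowerSeries.coeff d (term φ b)), map_sub, sub_eq_iff_eq_add]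
    have h0 : (0 : ℕ+ →₀ ℕ) ∈ partitionsLE (d 0) := mem_partitionsLE.2 (by simp [size])
    rw [Finset.filter_ne', ← term_zero hφ, Finset.sum_erase_add _ _ h0]
    rfl

theorem coeff_one_add_tsum_term {φ : F[X]} (hφ : φ.Monic) (hφ' : Irreducible φ)
    {d : Fin 2 →₀ ℕ} {n : ℕ} (hd : d 0 ≤ n) :
    MvPowerSeries.coeff d (1 + ∑' b : {b : ℕ+ →₀ ℕ // b ≠ 0}, term φ b) =
      MvPowerSeries.coeff d (∑ b ∈ partitionsLE n, term φ b) := by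
  have := t2Space_formalTopology
  rw [(hasSum_term hφ hφ').tsum_eq, add_sub_cancel, coeff_sum_term hφ' hd]
  rfl

/-- Expanding the product chooses one partition per prime; the resulting monomial has the total size
and the total number of parts as its exponents. -/
theorem coeff_prod_sum_term {κ : Type*} [Fintype κ] (θ : κ → F[X]) (d : Fin 2 →₀ ℕ) :
    MvPowerSeries.coeff d (∏ a, ∑ b ∈ partitionsLE (d 0), term (θ a) b) =
      ∑ β ∈ partitionFamilies θ (d 0) (d 1), ∏ a, (centralizerOrder (θ a) (β a) : ℚ)⁻¹ := by
  classical
  rw [Finset.prod_univ_sum, map_sum, partitionFamilies, Finset.sum_filter]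
  refine Finset.sum_congr (by congr) fun β _ => ?_
  simp_rw [term_eq_monomial]
  rw [MvPowerSeries.prod_monomial, MvPowerSeries.coeff_monomial]
  refine if_congr ?_ rfl rfl
  rw [Finsupp.ext_iff, Fin.forall_fin_two]
  simp [termExp, Finsupp.finsetSum_apply, eq_comm]

end Series

/-- Exponents that add up to `d` are each at most `d`, so higher coefficients of the factors do not
matter. -/
theorem coeff_prod_congr {ι σ R : Type*} [CommSemiring R] {f g : ι → MvPowerSeries σ R}
    {s : Finset ι} {d : σ →₀ ℕ}
    (h : ∀ i ∈ s, ∀ l ≤ d, MvPowerSeries.coeff l (f i) = MvPowerSeries.coeff l (g i)) :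
    MvPowerSeries.coeff d (∏ i ∈ s, f i) = MvPowerSeries.coeff d (∏ i ∈ s, g i) := by
  classical
  rw [MvPowerSeries.coeff_prod, MvPowerSeries.coeff_prod]
  refine Finset.sum_congr rfl fun l hl => Finset.prod_congr rfl fun i hi => h i hi _ ?_
  rw [← (Finset.mem_finsuppAntidiag.1 hl).1]
  exact Finset.single_le_sum (f := fun i => l i) (fun _ _ => zero_le) hi

end QStirling

theorem mainTheorem7 (F : Type*) [Field F] [Finite F] :
    (∀ φ : F[X], φ.Monic → Irreducible φ → φ ≠ X →
      Summable fun b : {b : ℕ+ →₀ ℕ // b ≠ 0} => QStirling.term φ b) ∧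
    HasProd
      (fun φ : {φ : F[X] // φ.Monic ∧ Irreducible φ ∧ φ ≠ X} =>
        1 + ∑' b : {b : ℕ+ →₀ ℕ // b ≠ 0}, QStirling.term (φ : F[X]) b)
      (QStirling.cycleSeries F) := by
  refine ⟨fun φ hφ hφ' _ => (QStirling.hasSum_term hφ hφ').summable, ?_⟩
  refine QStirling.hasProd_of_coeff fun d => ?_
  have hfin : {φ : {φ : F[X] // φ.Monic ∧ Irreducible φ ∧ φ ≠ X} |
      (φ : F[X]).natDegree ≤ d 0}.Finite :=
    (QStirling.finite_natDegree_le (d 0)).preimage Subtype.val_injective.injOn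
  -- The coefficient is already stable once all primes of degree at most `d 0` are present: the
  -- count by types holds for any finite set of primes containing these.
  refine ⟨hfin.toFinset, fun s hs => ?_⟩
  -- All factors are cut off at the same size `d 0`, which makes the product a finite sum of
  -- monomials.
  rw [QStirling.coeff_prod_congr (g := fun φ : {φ : F[X] // φ.Monic ∧ Irreducible φ ∧ φ ≠ X} =>
      ∑ b ∈ QStirling.partitionsLE (d 0), QStirling.term (φ : F[X]) b) fun φ _ l hl =>
        QStirling.coeff_one_add_tsum_term φ.2.1 φ.2.2.1 (hl 0),
    ← Finset.prod_coe_sort, QStirling.coeff_prod_sum_term (fun a : s => (a.1 : F[X]))]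
  refine (QStirling.cycleNumber_div_glOrder (θ := fun a : s => (a.1 : F[X])) (fun a => a.1.2)
    (Subtype.val_injective.comp Subtype.val_injective) (d 0) (d 1)
    fun φ h1 h2 h3 h4 => ⟨⟨⟨φ, h1, h2, h3⟩, hs (hfin.mem_toFinset.2 h4)⟩, rfl⟩).symm
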